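/- Let $e_k=\sum_{1\le i_1<\cdots<i_k}x_{i_1}\cdots x_{i_k}$ denote the elementary symmetric functions in infinitely many variables $x_1,x_2,\ldots$, with $e_0=1$ and $e_k=0$ for $k<0$, and for a partition $\lambda$ let $s_\lambda=\sum_T x^T$ be the Schur function, the sum being over all semistandard Young tableaux $T$ of shape $\lambda$ (and $s_\emptyset=1$). Then for every integer $r\ge 1$, $$\sum_{k=0}^r\left(e_{k-1}^2e_{r-k}^2+e_{k-2}e_ke_{r-k}^2-2e_{k-1}e_ke_{r-k-1}e_{r-k}\right)=\sum_\lambda s_\lambda,$$ where $\lambda$ ranges over all partitions of $2r-2$ of the form $(4^{i_4},3^{2i_3},2^{2i_2},1^{2i_1})$ with $i_1,i_2,i_3,i_4$ nonnegative integers (exponents denote multiplicities of parts). In particular, the left-hand side is Schur positive, that is, it is a finite linear combination of Schur functions with nonnegative integer coefficients. -/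

import Mathlib

namespace SymFun

/-- Formal power series with integer coefficients in the variables `x_0, x_1, x_2, …`; the ring in
which symmetric functions live. -/
abbrev Series : Type := MvPowerSeries ℕ ℤ

/-- The generating function `∑_t x^(w t)` of a family of monomials: the coefficient of `x^d` is the
number of indices `t` with `w t = d` (used only where that number is finite). -/
noncomputable def genFun {T : Type} (w : T → ℕ →₀ ℕ) : Series :=
  fun d => (Nat.card {t : T // w t = d} : ℤ)

/-- The exponent of the squarefree monomial `∏_{i ∈ s} x_i`. -/
noncomputable def squarefreeExp (s : Finset ℕ) : ℕ →₀ ℕ :=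
  ∑ i ∈ s, Finsupp.single i 1

/-- The elementary symmetric function `e_k = ∑_{i₁ < ⋯ < i_k} x_{i₁} ⋯ x_{i_k}`, for an integer
index `k`: a sum over the sets of `k` variables. It is `1` for `k = 0` and `0` for `k < 0`. -/
noncomputable def e (k : ℤ) : Series :=
  genFun fun s : {s : Finset ℕ // (s.card : ℤ) = k} => squarefreeExp s.1

/-- The type (content) of a semistandard tableau: the number of occurrences of each entry,
i.e. the exponent of the monomial `x^T`. -/
noncomputable def content {μ : YoungDiagram} (T : SemistandardYoungTableau μ) : ℕ →₀ ℕ :=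
  ∑ c ∈ μ.cells, Finsupp.single (T c.1 c.2) 1

/-- The Schur function `s_μ = ∑_T x^T`, over all semistandard Young tableaux of shape `μ`. -/
noncomputable def schur (μ : YoungDiagram) : Series :=
  genFun (content (μ := μ))

/-- The Young diagram of a partition: the parts are the row lengths, in weakly decreasing order. -/
def diagram {n : ℕ} (p : n.Partition) : YoungDiagram :=
  YoungDiagram.ofRowLens (p.parts.sort (· ≥ ·)) (Multiset.pairwise_sort p.parts (· ≥ ·)).sortedGE

/-- The partition `p` has the form `(4^{i₄}, 3^{2 i₃}, 2^{2 i₂}, 1^{2 i₁})`, with exponents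
denoting multiplicities of parts. -/
def HasSpecialForm {n : ℕ} (p : n.Partition) : Prop :=
  ∃ i₁ i₂ i₃ i₄ : ℕ,
    p.parts = Multiset.replicate i₄ 4 + Multiset.replicate (2 * i₃) 3 +
      Multiset.replicate (2 * i₂) 2 + Multiset.replicate (2 * i₁) 1

/-- `f` is Schur positive: it has a finite Schur expansion with nonnegative coefficients. -/
def SchurPositive (f : Series) : Prop :=
  ∃ a : YoungDiagram →₀ ℤ, (∀ μ, 0 ≤ a μ) ∧ f = ∑ μ ∈ a.support, a μ • schur μ

/-- The sets that contribute to a given coefficient of `e k` are finitely many. -/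
theorem finite_e_fiber (k : ℤ) (d : ℕ →₀ ℕ) :
    Finite {s : {s : Finset ℕ // (s.card : ℤ) = k} // squarefreeExp s.1 = d} := by
  have key : ∀ s : Finset ℕ, squarefreeExp s = d → s ⊆ d.support := by
    intro s hs i hi
    rw [← hs, Finsupp.mem_support_iff, squarefreeExp, Finsupp.finsetSum_apply]
    intro h0
    have := (Finset.sum_eq_zero_iff.mp h0) i hi
    simp at this
  refine Finite.of_injective
    (fun s => (⟨s.1.1, Finset.mem_powerset.mpr (key _ s.2)⟩ : {x // x ∈ d.support.powerset})) ?_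
  intro s t h
  exact Subtype.ext (Subtype.ext (Subtype.mk.inj h))

/-- The tableaux that contribute to a given coefficient of `schur μ` are finitely many. -/
theorem finite_schur_fiber (μ : YoungDiagram) (d : ℕ →₀ ℕ) :
    Finite {T : SemistandardYoungTableau μ // content T = d} := by
  have key : ∀ T : SemistandardYoungTableau μ, content T = d →
      ∀ c ∈ μ.cells, T c.1 c.2 ∈ d.support := by
    intro T hT c hc
    rw [← hT, Finsupp.mem_support_iff, content, Finsupp.finsetSum_apply]
    intro h0
    have := (Finset.sum_eq_zero_iff.mp h0) c hc
    simp at this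
  refine Finite.of_injective
    (fun T => fun c : {x // x ∈ μ.cells} =>
      (⟨T.1 c.1.1 c.1.2, key _ T.2 c.1 c.2⟩ : {x // x ∈ d.support})) ?_
  intro S T h
  refine Subtype.ext (SemistandardYoungTableau.ext fun i j => ?_)
  by_cases hc : (i, j) ∈ μ
  · exact congrArg Subtype.val (congrFun h ⟨(i, j), hc⟩)
  · rw [S.1.zeros hc, T.1.zeros hc]

end SymFun

/-!
The column lengths of a partition `(4^{i₄}, 3^{2 i₃}, 2^{2 i₂}, 1^{2 i₁})` are four integers
`a ≥ b ≥ c ≥ d ≥ 0` of equal parity, and by the dual Jacobi–Trudi formula its Schur function is the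
determinant of the rows `(e_i, e_{i-1}, e_{i-2}, e_{i-3})` for `i = d, c + 1, b + 2, a + 3`. So the
right-hand side is a sum of maximal minors of a matrix with four columns, over the increasing
quadruples of rows of alternating parity.

Such a sum over quadruples starting with a prescribed parity is the Pfaffian of a `4 × 4`
alternating matrix whose entries are sums of `2 × 2` minors (`sum_rowDet_eq_pfaffian`). In terms
of `p_j = ∑ e_l e_{l-j}`, let `A` and `A'` be the entries at `(0, 1)` for the two parities. The sums
telescope to `A + A' = p_0`, the entry at `(0, 2)` is `p_1` and the one at `(0, 3)` is `A + p_2`,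
respectively `A' + p_2`; shifting both indices by one interchanges the parities. Hence the two
Pfaffians are `A² - p_1² + (A + p_2) A'` and `A'² - p_1² + (A' + p_2) A`, and they add up to
`p_0² + p_0 p_2 - 2 p_1²` (`sum_alternating_rowDet`). The left-hand side is the component of
degree `2r - 2` of this expression.

All of this takes place in finitely many variables, where `e_k = 0` for large `k` and every sum is
finite; a coefficient of a symmetric function involves only finitely many variables (`mk_e`,
`mk_schur`). The dual Jacobi–Trudi formula (`schurPoly_eq_jacobiTrudiDet`) is proved by
induction on the number of variables. Removing the largest entry from the tableaux of shape `μ`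
removes a horizontal strip, that is, the bottom cells of a set of columns; on the other side,
`e_k(x_0, …, x_n) = e_k + x_n e_{k-1}` expands the determinant by multilinearity into a sum over all
sets of rows, in which the sets that do not leave a Young diagram give two equal rows or a zero row.
-/

namespace SymFun

/-! ### Minor summation for four columns -/

section MinorSummation

variable {R : Type*} [CommRing R]

/-- The determinant with rows `a`, `b`, `c`, `d`. -/
def rowDet (a b c d : Fin 4 → R) : R := (Matrix.of ![a, b, c, d]).det

theorem rowDet_eq (a b c d : Fin 4 → R) :
    rowDet a b c d =
      (a 0 * b 1 - a 1 * b 0) * (c 2 * d 3 - c 3 * d 2)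
      - (a 0 * b 2 - a 2 * b 0) * (c 1 * d 3 - c 3 * d 1)
      + (a 0 * b 3 - a 3 * b 0) * (c 1 * d 2 - c 2 * d 1)
      + (a 1 * b 2 - a 2 * b 1) * (c 0 * d 3 - c 3 * d 0)
      - (a 1 * b 3 - a 3 * b 1) * (c 0 * d 2 - c 2 * d 0)
      + (a 2 * b 3 - a 3 * b 2) * (c 0 * d 1 - c 1 * d 0) := by
  simp [rowDet, Matrix.det_succ_row_zero, Fin.sum_univ_succ, Fin.succAbove]
  ring

/-- The vector `∑_{i < m} p i • c i`. -/
def vecSum (p : ℕ → R) (c : ℕ → Fin 4 → R) (m : ℕ) (j : Fin 4) : R :=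
  ∑ i ∈ Finset.range m, p i * c i j

/-- The coordinates of the bivector `∑_{i < l < m} p i * q l • (c i ∧ c l)`. -/
def bivecSum (p q : ℕ → R) (c : ℕ → Fin 4 → R) (m : ℕ) (j k : Fin 4) : R :=
  ∑ l ∈ Finset.range m, ∑ i ∈ Finset.range l, p i * q l * (c i j * c l k - c i k * c l j)

/-- The coordinate of `w ∧ c ∧ d` for a bivector `w` and vectors `c`, `d`. -/
def bivecWedge (w : Fin 4 → Fin 4 → R) (c d : Fin 4 → R) : R :=
  w 0 1 * (c 2 * d 3 - c 3 * d 2) - w 0 2 * (c 1 * d 3 - c 3 * d 1)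
    + w 0 3 * (c 1 * d 2 - c 2 * d 1) + w 1 2 * (c 0 * d 3 - c 3 * d 0)
    - w 1 3 * (c 0 * d 2 - c 2 * d 0) + w 2 3 * (c 0 * d 1 - c 1 * d 0)

/-- The Pfaffian of the alternating `4 × 4` matrix with entries `w j k` for `j < k`. -/
def pfaffian (w : Fin 4 → Fin 4 → R) : R := w 0 1 * w 2 3 - w 0 2 * w 1 3 + w 0 3 * w 1 2

variable (p q : ℕ → R) (c : ℕ → Fin 4 → R)

theorem vecSum_succ (m : ℕ) (j : Fin 4) :
    vecSum p c (m + 1) j = vecSum p c m j + p m * c m j := Finset.sum_range_succ _ _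

theorem bivecSum_succ (m : ℕ) (j k : Fin 4) :
    bivecSum p q c (m + 1) j k = bivecSum p q c m j k
      + q m * (vecSum p c m j * c m k - vecSum p c m k * c m j) := by
  rw [bivecSum, Finset.sum_range_succ, ← bivecSum, add_right_inj, vecSum, vecSum, Finset.sum_mul,
    Finset.sum_mul, ← Finset.sum_sub_distrib, Finset.mul_sum]
  exact Finset.sum_congr rfl fun i _ => by ring

theorem sum_rowDet_first (m : ℕ) (b d f : Fin 4 → R) :
    ∑ i ∈ Finset.range m, p i * rowDet (c i) b d f = rowDet (vecSum p c m) b d f := by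
  induction m with
  | zero => simp [rowDet_eq, vecSum]
  | succ m ih =>
    rw [Finset.sum_range_succ, ih]
    simp only [rowDet_eq, vecSum_succ]
    ring

theorem sum_rowDet_vecSum (m : ℕ) (d f : Fin 4 → R) :
    ∑ l ∈ Finset.range m, q l * rowDet (vecSum p c l) (c l) d f
      = bivecWedge (bivecSum p q c m) d f := by
  induction m with
  | zero => simp [bivecWedge, bivecSum]
  | succ m ih =>
    rw [Finset.sum_range_succ, ih]
    simp only [rowDet_eq, bivecWedge, bivecSum_succ]
    ring

/-- Of the wedge `∑ p i * q l * p k • (c i ∧ c l ∧ c k)` over `i < l` and all `k`, only the terms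
with `i < l < k` survive: those with `k < l` cancel in pairs. -/
theorem sum_bivecWedge_bivecSum (m : ℕ) (f : Fin 4 → R) :
    ∑ k ∈ Finset.range m, p k * bivecWedge (bivecSum p q c k) (c k) f
      = bivecWedge (bivecSum p q c m) (vecSum p c m) f := by
  induction m with
  | zero => simp [bivecWedge, bivecSum]
  | succ m ih =>
    rw [Finset.sum_range_succ, ih]
    simp only [bivecWedge, bivecSum_succ, vecSum_succ]
    ring

theorem sum_bivecWedge_vecSum (m : ℕ) :
    ∑ k ∈ Finset.range m, q k * bivecWedge (bivecSum p q c k) (vecSum p c k) (c k)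
      = pfaffian (bivecSum p q c m) := by
  induction m with
  | zero => simp [pfaffian, bivecSum]
  | succ m ih =>
    rw [Finset.sum_range_succ, ih]
    simp only [bivecWedge, bivecSum_succ, pfaffian]
    ring

/-- Minor summation: the maximal minors of a matrix with four columns and rows `c i`, over the
quadruples of rows `w < x < y < z` with weight `p w * q x * p y * q z`, add up to a Pfaffian. -/
theorem sum_rowDet_eq_pfaffian (m : ℕ) :
    ∑ z ∈ Finset.range m, ∑ y ∈ Finset.range z, ∑ x ∈ Finset.range y, ∑ w ∈ Finset.range x,
        q z * (p y * (q x * (p w * rowDet (c w) (c x) (c y) (c z))))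
      = pfaffian (bivecSum p q c m) := by
  simp only [← Finset.mul_sum, sum_rowDet_first, sum_rowDet_vecSum,
    sum_bivecWedge_bivecSum, sum_bivecWedge_vecSum]

end MinorSummation

/-! ### Evaluation of the Pfaffians -/

section Evaluation

variable {R : Type*} [CommRing R]

/-- The indicator function of the integers congruent to `s` modulo `2`. -/
def parity (R : Type*) [CommRing R] (s l : ℤ) : R := if Even (l + s) then 1 else 0

theorem parity_congr {s t l m : ℤ} (h : Even (l + s) ↔ Even (m + t)) :
    parity R s l = parity R t m := by
  simp only [parity, h]

theorem parity_sub_one (s l : ℤ) : parity R (s + 1) (l - 1) = parity R s l :=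
  parity_congr (by rw [show l - 1 + (s + 1) = l + s by ring])

theorem parity_sub_two (s l : ℤ) : parity R s (l - 2) = parity R s l :=
  parity_congr (by rw [show l - 2 + s = l + s - 2 by ring]; simp)

theorem parity_add_two (s l : ℤ) : parity R (s + 1 + 1) l = parity R s l :=
  parity_congr (by rw [show l + (s + 1 + 1) = l + s + 2 by ring]; simp [Int.even_add])

theorem parity_add_parity (s l : ℤ) : parity R s l + parity R (s + 1) l = 1 := by
  have : Even (l + (s + 1)) ↔ ¬ Even (l + s) := by
    rw [← add_assoc]; exact Int.even_add_one
  by_cases h : Even (l + s) <;> simp [parity, this, h]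

theorem sum_range_shift {h : ℤ → R} {m : ℕ} (h0 : h (-1) = 0) (h1 : h (m - 1) = 0) :
    ∑ l ∈ Finset.range m, h ((l : ℤ) - 1) = ∑ l ∈ Finset.range m, h l := by
  have key : ∀ m : ℕ, ∑ l ∈ Finset.range m, h ((l : ℤ) - 1) + h (m - 1)
      = ∑ l ∈ Finset.range m, h l + h (-1) := by
    intro m
    induction m with
    | zero => simp
    | succ m ih =>
      rw [Finset.sum_range_succ, Finset.sum_range_succ, ih]
      push_cast
      rw [add_sub_cancel_right]
      ring
  simpa [h0, h1] using key m

theorem sum_range_shift_two {h : ℤ → R} {m : ℕ} (h0 : h (-1) = 0) (h0' : h (-2) = 0)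
    (h1 : h (m - 1) = 0) (h1' : h (m - 2) = 0) :
    ∑ l ∈ Finset.range m, h ((l : ℤ) - 2) = ∑ l ∈ Finset.range m, h l := by
  rw [← sum_range_shift h0 h1, ← sum_range_shift (h := fun l => h (l - 1)) (by simpa using h0')
    (by simpa [sub_sub] using h1')]
  simp [sub_sub]

/-- The sum of `u i` over `0 ≤ i < l` with `l - i` odd. -/
def altSum (u : ℤ → R) (l : ℤ) : R :=
  ∑ i ∈ Finset.range l.toNat, if Odd (l - i) then u i else 0

variable {u : ℤ → R}

theorem altSum_of_nonpos {l : ℤ} (hl : l ≤ 0) : altSum u l = 0 := by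
  simp [altSum, Int.toNat_of_nonpos hl]

theorem altSum_eq (hu : ∀ k < 0, u k = 0) (l : ℤ) : altSum u l = u (l - 1) + altSum u (l - 2) := by
  rcases le_or_gt l 0 with hl | hl
  · rw [altSum_of_nonpos hl, altSum_of_nonpos (by lia), hu _ (by lia), add_zero]
  obtain ⟨t, rfl⟩ : ∃ t : ℕ, l = t + 1 := ⟨(l - 1).toNat, by lia⟩
  cases t with
  | zero => simp [altSum]
  | succ t =>
    have h1 : ((t + 1 : ℕ) + 1 : ℤ).toNat = t + 1 + 1 := by lia
    have h2 : ((t + 1 : ℕ) + 1 - 2 : ℤ).toNat = t := by lia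
    have h3 : ¬ Odd (((t + 1 : ℕ) : ℤ) + 1 - (t : ℕ)) := by
      rw [show ((t + 1 : ℕ) : ℤ) + 1 - (t : ℕ) = 2 by push_cast; ring]; decide
    have h4 : Odd (((t + 1 : ℕ) : ℤ) + 1 - (t + 1 : ℕ)) := by
      rw [show ((t + 1 : ℕ) : ℤ) + 1 - (t + 1 : ℕ) = 1 by ring]; decide
    rw [altSum, h1, altSum, h2, Finset.sum_range_succ, Finset.sum_range_succ, if_neg h3, if_pos h4,
      add_zero, add_comm, add_sub_cancel_right]
    congr 1
    refine Finset.sum_congr rfl fun i _ => ?_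
    congr 1
    simp only [Int.odd_sub, Int.odd_add, eq_iff_iff]
    simp

/-- Shifting the argument of `u` by `j` in the alternating sum amounts to shifting `l` by `j`. -/
theorem sum_range_eq_altSum (hu : ∀ k < 0, u k = 0) (l j : ℕ) :
    ∑ i ∈ Finset.range l, (if Odd ((l : ℤ) - i) then u ((i : ℤ) - j) else 0) = altSum u (l - j) := by
  rcases le_or_gt l j with h | h
  · rw [altSum_of_nonpos (by lia)]
    refine Finset.sum_eq_zero fun i hi => ?_
    rw [Finset.mem_range] at hi
    rw [hu _ (by lia), ite_self]
  · obtain ⟨t, rfl⟩ := Nat.exists_eq_add_of_le h.le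
    rw [Finset.sum_range_add, Finset.sum_eq_zero, zero_add, altSum,
      show (((j + t : ℕ) : ℤ) - j).toNat = t by lia]
    · refine Finset.sum_congr rfl fun i _ => ?_
      push_cast
      rw [add_sub_cancel_left, add_sub_cancel_left, add_sub_add_left_eq_sub]
    · intro i hi
      rw [Finset.mem_range] at hi
      rw [hu _ (by lia), ite_self]

/-- The entry at `j < k` of the alternating matrix produced by minor summation from the rows
`(u i, u (i - 1), u (i - 2), u (i - 3))`, with the inner sum evaluated. -/
def pfaffianEntry (u : ℤ → R) (m : ℕ) (s j k : ℤ) : R :=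
  ∑ l ∈ Finset.range m,
    parity R s l * (altSum u (l - j) * u (l - k) - altSum u (l - k) * u (l - j))

theorem bivecSum_eq_pfaffianEntry (hu : ∀ k < 0, u k = 0) (m : ℕ) (s : ℤ) (j k : Fin 4) :
    bivecSum (fun i => parity R (s + 1) i) (fun l => parity R s l)
      (fun i (j : Fin 4) => u ((i : ℤ) - (j : ℕ))) m j k = pfaffianEntry u m s (j : ℕ) (k : ℕ) := by
  refine Finset.sum_congr rfl fun l _ => ?_
  rw [← sum_range_eq_altSum hu, ← sum_range_eq_altSum hu, Finset.sum_mul, Finset.sum_mul,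
    ← Finset.sum_sub_distrib, Finset.mul_sum]
  refine Finset.sum_congr rfl fun i _ => ?_
  by_cases hl : Even ((l : ℤ) + s)
  · have : Even ((i : ℤ) + (s + 1)) ↔ Odd ((l : ℤ) - i) := by
      rw [← Int.not_even_iff_odd]
      simp only [Int.even_sub, Int.even_add] at hl ⊢
      simp only [Int.not_even_one, iff_false]
      tauto
    simp only [parity, hl, if_true, this]
    split_ifs <;> ring
  · simp [parity, hl]

/-- Moving the index of summation by one interchanges the two parities. -/
theorem pfaffianEntry_succ {N : ℕ} (hu : ∀ k < 0, u k = 0) (hN : ∀ k : ℤ, N < k → u k = 0) (s : ℤ)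
    {j k : ℤ} (hj : 0 ≤ j) (hj' : j ≤ 2) (hk : 0 ≤ k) (hk' : k ≤ 2) :
    pfaffianEntry u (N + 4) s (j + 1) (k + 1) = pfaffianEntry u (N + 4) (s + 1) j k := by
  unfold pfaffianEntry
  rw [← sum_range_shift (h := fun l => parity R (s + 1) l
    * (altSum u (l - j) * u (l - k) - altSum u (l - k) * u (l - j)))]
  · refine Finset.sum_congr rfl fun l _ => ?_
    simp only [parity_sub_one, sub_sub, add_comm (1 : ℤ)]
  · rw [hu (-1 - k) (by lia), hu (-1 - j) (by lia)]; simp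
  · rw [hN (_ - k) (by push_cast; lia), hN (_ - j) (by push_cast; lia)]; simp

theorem pfaffianEntry_parity (m : ℕ) (s j k : ℤ) :
    pfaffianEntry u m (s + 1 + 1) j k = pfaffianEntry u m s j k := by
  simp only [pfaffianEntry, parity_add_two]

/-- By `altSum_eq` the summand of the left-hand side at `l` is `u (l - 1) ^ 2 + H (l - 1) - H l` with
`H l = altSum u (l - 1) * u l`. -/
theorem pfaffianEntry_zero_one {N : ℕ} (hu : ∀ k < 0, u k = 0) (hN : ∀ k : ℤ, N < k → u k = 0)
    (s : ℤ) : pfaffianEntry u (N + 4) s 0 1 + pfaffianEntry u (N + 4) (s + 1) 0 1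
      = ∑ l ∈ Finset.range (N + 4), u l ^ 2 := by
  have h1 := sum_range_shift (h := fun l => u l ^ 2) (m := N + 4) (by simp [hu])
    (by rw [hN _ (by push_cast; lia)]; simp)
  have h2 := sum_range_shift (h := fun l => altSum u (l - 1) * u l) (m := N + 4) (by simp [hu])
    (by rw [hN (_ - 1) (by push_cast; lia)]; simp)
  rw [← h1, ← sub_eq_zero]
  rw [← sub_eq_zero, ← Finset.sum_sub_distrib] at h2
  rw [← h2]
  unfold pfaffianEntry
  rw [← Finset.sum_add_distrib, ← Finset.sum_sub_distrib]
  refine Finset.sum_congr rfl fun l _ => ?_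
  simp only [sub_zero]
  rw [← add_mul, parity_add_parity, altSum_eq hu l, sub_sub (l : ℤ) 1 1, one_add_one_eq_two]
  ring

/-- By `altSum_eq` the summand at `l` is
`u (l - 1) * u (l - 2) + u (l - 2) * u (l - 3) + H (l - 2) - H l`
with `H l = u l * altSum u (l - 2)`; the first two terms contribute the sum over the two parities. -/
theorem pfaffianEntry_zero_two {N : ℕ} (hu : ∀ k < 0, u k = 0) (hN : ∀ k : ℤ, N < k → u k = 0)
    (s : ℤ) : pfaffianEntry u (N + 4) s 0 2 = ∑ l ∈ Finset.range (N + 4), u l * u (l - 1) := by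
  have h1 := sum_range_shift (h := fun l => u l * u (l - 1)) (m := N + 4) (by simp [hu])
    (by rw [hN (_ - 1) (by push_cast; lia)]; simp)
  have h2 := sum_range_shift (h := fun l => parity R (s + 1) l * (u (l - 1) * u (l - 2)))
    (m := N + 4) (by simp [hu])
    (by rw [hN (_ - 1 - 1) (by push_cast; lia)]; simp)
  have h3 := sum_range_shift_two (h := fun l => parity R s l * (u l * altSum u (l - 2)))
    (m := N + 4) (by simp [hu]) (by simp [hu])
    (by rw [hN (_ - 1) (by push_cast; lia)]; simp)
    (by rw [hN (_ - 2) (by push_cast; lia)]; simp)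
  rw [← h1, ← sub_eq_zero]
  rw [← sub_eq_zero, ← Finset.sum_sub_distrib] at h2 h3
  rw [← add_zero (0 : R)]
  nth_rewrite 1 [← h2]
  rw [← h3]
  unfold pfaffianEntry
  rw [← Finset.sum_add_distrib, ← Finset.sum_sub_distrib]
  refine Finset.sum_congr rfl fun l _ => ?_
  have hp := parity_add_parity (R := R) s l
  have ha := altSum_eq hu l
  have hb := altSum_eq hu ((l : ℤ) - 2)
  simp only [parity_sub_one, parity_sub_two, sub_sub, sub_zero] at *
  norm_num at *
  rw [ha, hb]
  linear_combination (u ((l : ℤ) - 1) * u ((l : ℤ) - 2)) * hp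

/-- By `altSum_eq` the summands at `l` differ by
`u l * u (l - 2) + u (l - 1) * u (l - 3) + H (l - 2) - H l` with `H l = u (l - 1) * altSum u l`. -/
theorem pfaffianEntry_zero_three {N : ℕ} (hu : ∀ k < 0, u k = 0) (hN : ∀ k : ℤ, N < k → u k = 0)
    (s : ℤ) : pfaffianEntry u (N + 4) s 0 3 = pfaffianEntry u (N + 4) s 0 1
      + ∑ l ∈ Finset.range (N + 4), u l * u (l - 2) := by
  have h2 := sum_range_shift (h := fun l => parity R (s + 1) l * (u l * u (l - 2)))
    (m := N + 4) (by simp [hu])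
    (by rw [hN (_ - 1) (by push_cast; lia)]; simp)
  have h3 := sum_range_shift_two (h := fun l => parity R s l * (u (l - 1) * altSum u l))
    (m := N + 4) (by simp [hu]) (by simp [hu])
    (by rw [hN (_ - 1 - 1) (by push_cast; lia)]; simp)
    (by rw [hN (_ - 2 - 1) (by push_cast; lia)]; simp)
  rw [← sub_eq_zero]
  rw [← sub_eq_zero, ← Finset.sum_sub_distrib] at h2 h3
  rw [← add_zero (0 : R)]
  nth_rewrite 1 [← h2]
  rw [← h3]
  unfold pfaffianEntry
  rw [← Finset.sum_add_distrib, ← Finset.sum_add_distrib, ← Finset.sum_sub_distrib]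
  refine Finset.sum_congr rfl fun l _ => ?_
  have hp := parity_add_parity (R := R) s l
  have ha := altSum_eq hu l
  have hb := altSum_eq hu ((l : ℤ) - 1)
  simp only [parity_sub_one, parity_sub_two, sub_sub, sub_zero] at *
  norm_num at *
  rw [ha, hb]
  linear_combination (u (l : ℤ) * u ((l : ℤ) - 2)) * hp

theorem sum_parity_rowDet (hu : ∀ k < 0, u k = 0) (m : ℕ) (s : ℤ) (c : ℕ → Fin 4 → R)
    (hc : ∀ i j, c i j = u ((i : ℤ) - (j : ℕ))) :
    ∑ z ∈ Finset.range m, ∑ y ∈ Finset.range z, ∑ x ∈ Finset.range y, ∑ w ∈ Finset.range x,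
        parity R s z * (parity R (s + 1) y * (parity R s x * (parity R (s + 1) w
          * rowDet (c w) (c x) (c y) (c z))))
      = pfaffianEntry u m s 0 1 * pfaffianEntry u m s 2 3
        - pfaffianEntry u m s 0 2 * pfaffianEntry u m s 1 3
        + pfaffianEntry u m s 0 3 * pfaffianEntry u m s 1 2 := by
  obtain rfl : c = fun (i : ℕ) (j : Fin 4) => u ((i : ℤ) - (j : ℕ)) := by funext i j; exact hc i j
  rw [sum_rowDet_eq_pfaffian (fun i => parity R (s + 1) i) (fun i => parity R s i), pfaffian]
  simp only [bivecSum_eq_pfaffianEntry hu]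
  rfl

/-- The sum of the determinants with rows `(u i, u (i - 1), u (i - 2), u (i - 3))` for
`i = w, x, y, z`, over all increasing quadruples of alternating parity. -/
theorem sum_alternating_rowDet {N : ℕ} (hu : ∀ k < 0, u k = 0) (hN : ∀ k : ℤ, N < k → u k = 0)
    (c : ℕ → Fin 4 → R) (hc : ∀ i j, c i j = u ((i : ℤ) - (j : ℕ))) :
    ∑ z ∈ Finset.range (N + 4), ∑ y ∈ Finset.range z, ∑ x ∈ Finset.range y, ∑ w ∈ Finset.range x,
        (if Odd (z + y) ∧ Odd (y + x) ∧ Odd (x + w) then rowDet (c w) (c x) (c y) (c z) else 0)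
      = (∑ l ∈ Finset.range (N + 4), u l ^ 2) ^ 2
        + (∑ l ∈ Finset.range (N + 4), u l * u (l - 2)) * (∑ l ∈ Finset.range (N + 4), u l ^ 2)
        - 2 * (∑ l ∈ Finset.range (N + 4), u l * u (l - 1)) ^ 2 := by
  have h12 := fun s => pfaffianEntry_succ hu hN s (j := 0) (k := 1) (by simp) (by simp) (by simp)
    (by simp)
  have h23 := fun s => pfaffianEntry_succ hu hN s (j := 1) (k := 2) (by simp) (by simp) (by simp)
    (by simp)
  have h13 := fun s => pfaffianEntry_succ hu hN s (j := 0) (k := 2) (by simp) (by simp) (by simp)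
    (by simp)
  norm_num at h12 h23 h13
  have h01 := pfaffianEntry_zero_one hu hN 0
  have key := congrArg₂ (· + ·) (sum_parity_rowDet hu (N + 4) 0 c hc)
    (sum_parity_rowDet hu (N + 4) 1 c hc)
  simp only [h23, h13, h12, pfaffianEntry_parity, pfaffianEntry_zero_two hu hN,
    pfaffianEntry_zero_three hu hN, ← Finset.sum_add_distrib] at key
  have h2 := pfaffianEntry_parity (u := u) (N + 4) 0 0 1
  rw [zero_add] at h01 h2 key
  rw [h2] at key
  rw [← h01]
  refine Eq.trans ?_ (key.trans (by ring))
  refine Finset.sum_congr rfl fun z _ => Finset.sum_congr rfl fun y _ => Finset.sum_congr rfl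
    fun x _ => Finset.sum_congr rfl fun w _ => ?_
  simp only [parity, Int.even_add, Int.even_coe_nat, ← Nat.not_even_iff_odd, Nat.even_add]
  by_cases hw : Even w <;> by_cases hx : Even x <;> by_cases hy : Even y <;>
    by_cases hz : Even z <;> simp [hw, hx, hy, hz]

end Evaluation

/-! ### The dual Jacobi–Trudi formula in finitely many variables -/

section JacobiTrudiDet

variable {R : Type*} [CommRing R]

/-- The dual Jacobi–Trudi determinant `det (u (α i - i + j))`, with rows and columns numbered from
`0`. For `u k = e k` this is the Schur function of the shape with column lengths `α`. -/
def jacobiTrudiDet (u : ℤ → R) {k : ℕ} (α : Fin k → ℤ) : R :=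
  (Matrix.of fun i j : Fin k => u (α i - (i : ℕ) + (j : ℕ))).det

/-- Adjoining a variable `x` to the elementary symmetric polynomials expands the determinant by
multilinearity in the rows. -/
theorem jacobiTrudiDet_expand {u v : ℤ → R} {x : R} (h : ∀ m, v m = u m + x * u (m - 1)) {k : ℕ}
    (α : Fin k → ℤ) :
    jacobiTrudiDet v α = ∑ S : Finset (Fin k),
      x ^ S.card * jacobiTrudiDet u (fun i => α i - if i ∈ S then 1 else 0) := by
  have hrow : (Matrix.of fun i j : Fin k => v (α i - (i : ℕ) + (j : ℕ)))
      = (x • fun i j : Fin k => u (α i - 1 - (i : ℕ) + (j : ℕ)))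
        + fun i j : Fin k => u (α i - (i : ℕ) + (j : ℕ)) := by
    funext i j
    simp only [Matrix.of_apply, Pi.add_apply, Pi.smul_apply, smul_eq_mul, h]
    rw [add_comm, show α i - (i : ℕ) + (j : ℕ) - 1 = α i - 1 - (i : ℕ) + (j : ℕ) by ring]
  have hadd := (Matrix.detRowAlternating (R := R) (n := Fin k)).toMultilinearMap.map_add_univ
    (x • fun i j : Fin k => u (α i - 1 - (i : ℕ) + (j : ℕ)))
    (fun i j : Fin k => u (α i - (i : ℕ) + (j : ℕ)))
  rw [jacobiTrudiDet, hrow]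
  refine hadd.trans (Finset.sum_congr rfl fun S _ => ?_)
  have hsmul := (Matrix.detRowAlternating (R := R) (n := Fin k)).toMultilinearMap.map_piecewise_smul
    (fun _ => x)
    (S.piecewise (fun i j : Fin k => u (α i - 1 - (i : ℕ) + (j : ℕ)))
      (fun i j : Fin k => u (α i - (i : ℕ) + (j : ℕ)))) S
  rw [Finset.prod_const, smul_eq_mul] at hsmul
  refine Eq.trans ?_ (hsmul.trans ?_)
  · congr 1
    funext i
    by_cases hi : i ∈ S <;> simp [hi]
  · refine congrArg (fun M : Matrix (Fin k) (Fin k) R => x ^ S.card * M.det) ?_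
    funext i j
    by_cases hi : i ∈ S <;> simp [hi]

/-- The rows `i` and `i + 1` are equal. -/
theorem jacobiTrudiDet_eq_zero_of_succ {u : ℤ → R} {k : ℕ} {α : Fin k → ℤ} {i j : Fin k}
    (hij : (j : ℕ) = i + 1) (h : α j = α i + 1) : jacobiTrudiDet u α = 0 := by
  refine Matrix.det_zero_of_row_eq (i := i) (j := j) (fun h => by simp [h] at hij) ?_
  funext l
  simp only [Matrix.of_apply]
  rw [h, hij]
  congr 1
  push_cast
  ring

/-- All indices in the last row are negative. -/
theorem jacobiTrudiDet_eq_zero_of_last {u : ℤ → R} (hu : ∀ m < 0, u m = 0) {k : ℕ}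
    {α : Fin k → ℤ} {i : Fin k} (hi : (i : ℕ) + 1 = k) (h : α i = -1) :
    jacobiTrudiDet u α = 0 := by
  refine Matrix.det_eq_zero_of_row_eq_zero i fun l => ?_
  simp only [Matrix.of_apply]
  have := l.2
  exact hu _ (by lia)

end JacobiTrudiDet

/-- The elementary symmetric polynomial `e_k` in the variables `x_0, …, x_{n-1}`. -/
noncomputable def elemPoly (n : ℕ) (k : ℤ) : Series :=
  ∑ s ∈ (Finset.range n).powerset,
    if (s.card : ℤ) = k then MvPowerSeries.monomial (squarefreeExp s) 1 else 0

theorem elemPoly_zero (k : ℤ) : elemPoly 0 k = if k = 0 then 1 else 0 := by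
  simp [elemPoly, squarefreeExp, eq_comm]

theorem elemPoly_of_neg (n : ℕ) {k : ℤ} (hk : k < 0) : elemPoly n k = 0 :=
  Finset.sum_eq_zero fun s _ => if_neg (by lia)

theorem elemPoly_of_lt {n : ℕ} {k : ℤ} (hk : n < k) : elemPoly n k = 0 := by
  refine Finset.sum_eq_zero fun s hs => if_neg ?_
  have := Finset.card_le_card (Finset.mem_powerset.mp hs)
  rw [Finset.card_range] at this
  lia

theorem elemPoly_succ (n : ℕ) (k : ℤ) :
    elemPoly (n + 1) k = elemPoly n k + MvPowerSeries.X n * elemPoly n (k - 1) := by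
  rw [elemPoly, Finset.range_add_one, Finset.sum_powerset_insert Finset.notMem_range_self,
    ← elemPoly, elemPoly, elemPoly, add_right_inj, Finset.mul_sum]
  refine Finset.sum_congr rfl fun s hs => ?_
  have hn : n ∉ s := fun h => by simpa using Finset.mem_powerset.mp hs h
  rw [Finset.card_insert_of_notMem hn, squarefreeExp, Finset.sum_insert hn, ← squarefreeExp]
  have : ((s.card + 1 : ℕ) : ℤ) = k ↔ (s.card : ℤ) = k - 1 := by push_cast; lia
  simp only [this, MvPowerSeries.X]
  split_ifs
  · rw [MvPowerSeries.monomial_mul_monomial, one_mul]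
  · rw [mul_zero]

/-- The semistandard tableaux of shape `μ` with entries less than `n`. -/
abbrev BoundedTableau (n : ℕ) (μ : YoungDiagram) : Type :=
  {T : SemistandardYoungTableau μ // ∀ i j, (i, j) ∈ μ → T i j < n}

instance (n : ℕ) (μ : YoungDiagram) : Finite (BoundedTableau n μ) := by
  refine Finite.of_injective
    (fun T => fun c : {x // x ∈ μ.cells} => (⟨T.1 c.1.1 c.1.2, T.2 _ _ c.2⟩ : Fin n)) ?_
  intro S T h
  refine Subtype.ext (SemistandardYoungTableau.ext fun i j => ?_)
  by_cases hc : (i, j) ∈ μ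
  · exact congrArg Fin.val (congrFun h ⟨(i, j), hc⟩)
  · rw [S.1.zeros hc, T.1.zeros hc]

noncomputable instance (n : ℕ) (μ : YoungDiagram) : Fintype (BoundedTableau n μ) :=
  Fintype.ofFinite _

/-- The Schur polynomial of shape `μ` in the variables `x_0, …, x_{n-1}`. -/
noncomputable def schurPoly (n : ℕ) (μ : YoungDiagram) : Series :=
  ∑ T : BoundedTableau n μ, MvPowerSeries.monomial (content T.1) 1

/-- The Young diagram whose column `j` has length `b j`, for `j < k`. -/
def ofColLens (k : ℕ) (b : ℕ → ℕ) (hb : Antitone b) : YoungDiagram where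
  cells := {c ∈ Finset.range (b 0) ×ˢ Finset.range k | c.1 < b c.2}
  isLowerSet := by
    rintro ⟨i, j⟩ ⟨i', j'⟩ ⟨hi, hj⟩ h
    simp only [Finset.coe_filter, Finset.mem_product, Finset.mem_range, Set.mem_ofPred_eq] at *
    have h1 : b j' ≤ b 0 := hb (Nat.zero_le _)
    have h2 : b j ≤ b j' := hb hj
    lia

theorem mem_ofColLens {k : ℕ} {b : ℕ → ℕ} {hb : Antitone b} {i j : ℕ} :
    (i, j) ∈ ofColLens k b hb ↔ j < k ∧ i < b j := by
  rw [← YoungDiagram.mem_cells]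
  simp only [ofColLens, Finset.mem_filter, Finset.mem_product, Finset.mem_range]
  have h1 : b j ≤ b 0 := hb (Nat.zero_le _)
  lia

theorem colLen_ofColLens {k : ℕ} {b : ℕ → ℕ} {hb : Antitone b} {j : ℕ} (hj : j < k) :
    (ofColLens k b hb).colLen j = b j := by
  refine eq_of_forall_lt_iff fun i => ?_
  rw [← YoungDiagram.mem_iff_lt_colLen, mem_ofColLens]
  exact and_iff_right hj

/-- The restriction of a tableau to a smaller shape. -/
def restrictTableau {μ ν : YoungDiagram} (h : ν ≤ μ) (T : SemistandardYoungTableau μ) :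
    SemistandardYoungTableau ν where
  entry i j := if (i, j) ∈ ν then T i j else 0
  row_weak' hj hc := by
    rw [if_pos hc, if_pos (ν.up_left_mem le_rfl hj.le hc)]
    exact T.row_weak hj (h hc)
  col_strict' hi hc := by
    rw [if_pos hc, if_pos (ν.up_left_mem hi.le le_rfl hc)]
    exact T.col_strict hi (h hc)
  zeros' hc := if_neg hc

/-- The extension of a tableau of shape `ν` with entries less than `n` to a shape `μ` for which
`μ / ν` is a horizontal strip, with entry `n` on the strip. -/
def extendTableau {μ ν : YoungDiagram} (n : ℕ)
    (hstrip : ∀ {i₁ i₂ j : ℕ}, i₁ < i₂ → (i₂, j) ∈ μ → (i₁, j) ∈ ν) (T : BoundedTableau n ν)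
    (h : ν ≤ μ) :
    SemistandardYoungTableau μ where
  entry i j := if (i, j) ∈ ν then T.1 i j else if (i, j) ∈ μ then n else 0
  row_weak' {i j₁ j₂} hj hc := by
    by_cases h₂ : (i, j₂) ∈ ν
    · rw [if_pos h₂, if_pos (ν.up_left_mem le_rfl hj.le h₂)]
      exact T.1.row_weak hj h₂
    · rw [if_neg h₂, if_pos hc]
      split_ifs with h₁
      exacts [(T.2 _ _ h₁).le, le_rfl, Nat.zero_le _]
  col_strict' {i₁ i₂ j} hi hc := by
    rw [if_pos (hstrip hi hc)]
    split_ifs with h₂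
    exacts [T.1.col_strict hi h₂, T.2 _ _ (hstrip hi hc)]
  zeros' {i j} hc := by rw [if_neg fun h' => hc (h h'), if_neg hc]

open scoped Classical in
/-- The columns of a tableau that contain the entry `n`. -/
noncomputable def topColumns (n k : ℕ) {μ : YoungDiagram} (T : SemistandardYoungTableau μ) :
    Finset (Fin k) :=
  {j | ∃ i, (i, (j : ℕ)) ∈ μ ∧ T i j = n}

theorem mem_topColumns {n k : ℕ} {μ : YoungDiagram} {T : SemistandardYoungTableau μ} {j : Fin k} :
    j ∈ topColumns n k T ↔ ∃ i, (i, (j : ℕ)) ∈ μ ∧ T i j = n := by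
  simp [topColumns]

section Branching

variable {n k : ℕ} {μ : YoungDiagram} (hμ : ∀ i j, (i, j) ∈ μ → j < k) (S : Finset (Fin k))

/-- The column lengths of `μ`, decreased by one in the columns of `S`. -/
def strippedLen (μ : YoungDiagram) (S : Finset (Fin k)) (j : ℕ) : ℕ :=
  μ.colLen j - if j ∈ S.map Fin.valEmbedding then 1 else 0

/-- The condition that the bottom cells of the columns in `S` form a horizontal strip whose removal
from `μ` leaves a Young diagram. -/
def IsRemovable (μ : YoungDiagram) (S : Finset (Fin k)) : Prop :=
  ∀ j ∈ S.map Fin.valEmbedding, μ.colLen (j + 1) < μ.colLen j ∨ j + 1 ∈ S.map Fin.valEmbedding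

variable {S}

/-- The natural subtraction in `strippedLen` does not truncate. -/
theorem IsRemovable.colLen_pos (hS : IsRemovable μ S) (j : ℕ) (hj : j ∈ S.map Fin.valEmbedding) :
    0 < μ.colLen j := by
  have hk : j < k := by
    obtain ⟨i, -, rfl⟩ := Finset.mem_map.mp hj
    exact i.2
  induction h : k - j generalizing j with
  | zero => lia
  | succ m ih =>
    rcases hS j hj with h1 | h1
    · lia
    · have h2 : j + 1 < k := by
        obtain ⟨i, -, hi⟩ := Finset.mem_map.mp h1
        rw [← hi]; exact i.2
      exact (ih (j + 1) h1 h2 (by lia)).trans_le (μ.colLen_anti j (j + 1) (by lia))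

theorem IsRemovable.antitone (hS : IsRemovable μ S) : Antitone (strippedLen μ S) := by
  refine antitone_nat_of_succ_le fun j => ?_
  have h := μ.colLen_anti j (j + 1) (by lia)
  have h' := hS j
  unfold strippedLen
  split_ifs at * <;> lia

/-- In each column only the bottom cell can carry the maximal entry. -/
theorem entry_eq_max_iff {T : BoundedTableau (n + 1) μ} (hT : topColumns n k T.1 = S) {i j : ℕ}
    (hj : j < k) (hc : (i, j) ∈ μ) :
    T.1 i j = n ↔ i + 1 = μ.colLen j ∧ j ∈ S.map Fin.valEmbedding := by
  have key : ∀ i, (i, j) ∈ μ → T.1 i j = n → i + 1 = μ.colLen j := by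
    intro i hc h
    have h1 := YoungDiagram.mem_iff_lt_colLen.mp hc
    by_contra h2
    have h3 : (i + 1, j) ∈ μ := YoungDiagram.mem_iff_lt_colLen.mpr (by lia)
    have := T.1.col_strict (Nat.lt_succ_self i) h3
    have := T.2 _ _ h3
    lia
  have hmem : j ∈ S.map Fin.valEmbedding ↔ ∃ i, (i, j) ∈ μ ∧ T.1 i j = n := by
    rw [← hT]
    simp only [Finset.mem_map, mem_topColumns, Fin.valEmbedding_apply]
    exact ⟨by rintro ⟨a, h, rfl⟩; exact h, fun h => ⟨⟨j, hj⟩, h, rfl⟩⟩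
  rw [hmem]
  refine ⟨fun h => ⟨key i hc h, i, hc, h⟩, ?_⟩
  rintro ⟨h, i', hc', h'⟩
  have := key i' hc' h'
  obtain rfl : i = i' := by lia
  exact h'

include hμ in
/-- Rows increase weakly, so a maximal entry has only maximal entries to its right. -/
theorem isRemovable_topColumns (T : BoundedTableau (n + 1) μ) :
    IsRemovable μ (topColumns n k T.1) := by
  intro j hj
  by_contra! hcon
  obtain ⟨h1, h2⟩ := hcon
  have hjk : j < k := by
    obtain ⟨i, -, rfl⟩ := Finset.mem_map.mp hj
    exact i.2
  obtain ⟨i, hc, hi⟩ : ∃ i, (i, j) ∈ μ ∧ T.1 i j = n := by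
    obtain ⟨j, hj', rfl⟩ := Finset.mem_map.mp hj
    exact mem_topColumns.mp hj'
  have hc' : (i, j + 1) ∈ μ :=
    YoungDiagram.mem_iff_lt_colLen.mpr ((YoungDiagram.mem_iff_lt_colLen.mp hc).trans_le h1)
  have h3 := T.1.row_weak (Nat.lt_succ_self j) hc'
  have h4 := T.2 _ _ hc'
  exact h2 ((entry_eq_max_iff rfl (hμ _ _ hc') hc').mp (by lia)).2

theorem ofColLens_strippedLen_le (hS : IsRemovable μ S) :
    ofColLens k (strippedLen μ S) hS.antitone ≤ μ := by
  rintro ⟨i, j⟩ h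
  rw [mem_ofColLens, strippedLen] at h
  exact YoungDiagram.mem_iff_lt_colLen.mpr (by lia)

theorem mem_iff_of_strip (hS : IsRemovable μ S) {i j : ℕ} (hj : j < k) (hc : (i, j) ∈ μ) :
    (i, j) ∈ ofColLens k (strippedLen μ S) hS.antitone
      ↔ ¬ (i + 1 = μ.colLen j ∧ j ∈ S.map Fin.valEmbedding) := by
  have := YoungDiagram.mem_iff_lt_colLen.mp hc
  rw [mem_ofColLens, strippedLen]
  split_ifs with h <;> simp only [h, hj] <;> lia

include hμ in
theorem content_eq_add (hS : IsRemovable μ S) {T : SemistandardYoungTableau μ}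
    {T' : SemistandardYoungTableau (ofColLens k (strippedLen μ S) hS.antitone)}
    (h1 : ∀ i j, (i, j) ∈ ofColLens k (strippedLen μ S) hS.antitone → T i j = T' i j)
    (h2 : ∀ i j, (i, j) ∈ μ → (i, j) ∉ ofColLens k (strippedLen μ S) hS.antitone → T i j = n) :
    content T = Finsupp.single n S.card + content T' := by
  have hle := YoungDiagram.cells_subset_iff.mpr (ofColLens_strippedLen_le hS)
  rw [content, ← Finset.sum_sdiff hle]
  congr 1
  · have hcard : (μ.cells \ (ofColLens k (strippedLen μ S) hS.antitone).cells).card = S.card := by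
      symm
      refine Finset.card_bij (fun j _ => (μ.colLen j - 1, (j : ℕ))) ?_ ?_ ?_
      · intro j hj
        have hj' : (j : ℕ) ∈ S.map Fin.valEmbedding := Finset.mem_map_of_mem Fin.valEmbedding hj
        have hpos := hS.colLen_pos j hj'
        have hc : (μ.colLen j - 1, (j : ℕ)) ∈ μ := YoungDiagram.mem_iff_lt_colLen.mpr (by lia)
        rw [Finset.mem_sdiff, YoungDiagram.mem_cells, YoungDiagram.mem_cells,
          mem_iff_of_strip hS j.2 hc, not_not]
        exact ⟨hc, by lia, hj'⟩
      · intro j _ j' _ h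
        exact Fin.ext (Prod.mk.inj h).2
      · rintro ⟨i, j⟩ h
        rw [Finset.mem_sdiff, YoungDiagram.mem_cells, YoungDiagram.mem_cells] at h
        have hjk := hμ _ _ h.1
        rw [mem_iff_of_strip hS hjk h.1, not_not] at h
        obtain ⟨hc, h3, h4⟩ := h
        obtain ⟨j, hj, rfl⟩ := Finset.mem_map.mp h4
        refine ⟨j, hj, ?_⟩
        rw [Fin.valEmbedding_apply] at *
        rw [← h3, Nat.add_sub_cancel]
    rw [← hcard, Finset.sum_congr rfl (g := fun _ => Finsupp.single n 1), Finset.sum_const,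
      Finsupp.smul_single, smul_eq_mul, mul_one]
    rintro ⟨i, j⟩ h
    rw [Finset.mem_sdiff, YoungDiagram.mem_cells, YoungDiagram.mem_cells] at h
    rw [h2 i j h.1 h.2]
  · refine Finset.sum_congr rfl fun c hc => ?_
    rw [h1 _ _ hc]

open scoped Classical in
include hμ in
theorem sum_topColumns_eq (hS : IsRemovable μ S) :
    ∑ T : BoundedTableau (n + 1) μ with topColumns n k T.1 = S,
        MvPowerSeries.monomial (content T.1) (1 : ℤ)
      = MvPowerSeries.X n ^ S.card
        * schurPoly n (ofColLens k (strippedLen μ S) hS.antitone) := by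
  have hle := ofColLens_strippedLen_le hS
  have hstrip : ∀ {i₁ i₂ j : ℕ}, i₁ < i₂ → (i₂, j) ∈ μ →
      (i₁, j) ∈ ofColLens k (strippedLen μ S) hS.antitone := by
    intro i₁ i₂ j hi hc
    rw [mem_iff_of_strip hS (hμ _ _ hc) (μ.up_left_mem hi.le le_rfl hc)]
    have := YoungDiagram.mem_iff_lt_colLen.mp hc
    lia
  have hlt : ∀ T : BoundedTableau (n + 1) μ, topColumns n k T.1 = S → ∀ i j, (i, j) ∈ μ →
      ((i, j) ∈ ofColLens k (strippedLen μ S) hS.antitone ↔ T.1 i j ≠ n) := by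
    intro T hT i j hc
    rw [mem_iff_of_strip hS (hμ _ _ hc) hc, ne_eq, entry_eq_max_iff hT (hμ _ _ hc) hc]
  rw [schurPoly, Finset.mul_sum]
  refine Finset.sum_bij'
    (fun T hT => ⟨restrictTableau hle T.1, fun i j hc => ?_⟩)
    (fun T _ => ⟨extendTableau n hstrip T hle, fun i j hc => ?_⟩) ?_ ?_ ?_ ?_ ?_
  · have h1 := T.2 i j (hle hc)
    have h2 := (hlt T (Finset.mem_filter.mp hT).2 i j (hle hc)).mp hc
    change (if (i, j) ∈ _ then T.1 i j else 0) < n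
    rw [if_pos hc]
    lia
  · change (if (i, j) ∈ _ then T.1 i j else if (i, j) ∈ μ then n else 0) < n + 1
    split_ifs with h
    · exact (T.2 i j h).trans (Nat.lt_succ_self n)
    · exact Nat.lt_succ_self n
  · intro T _
    exact Finset.mem_univ _
  · intro T _
    refine Finset.mem_filter.mpr ⟨Finset.mem_univ _, ?_⟩
    ext j
    rw [mem_topColumns]
    have hj : j ∈ S ↔ (j : ℕ) ∈ S.map Fin.valEmbedding :=
      (Finset.mem_map' Fin.valEmbedding).symm
    constructor
    · rintro ⟨i, hc, h⟩
      change (if (i, (j : ℕ)) ∈ _ then T.1 i j else if (i, (j : ℕ)) ∈ μ then n else 0) = n at h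
      have hn : (i, (j : ℕ)) ∉ ofColLens k (strippedLen μ S) hS.antitone := by
        intro h'
        rw [if_pos h'] at h
        exact (T.2 _ _ h').ne h
      rw [mem_iff_of_strip hS j.2 hc, not_not] at hn
      exact hj.mpr hn.2
    · intro h
      have hpos := hS.colLen_pos j (hj.mp h)
      have hc : (μ.colLen j - 1, (j : ℕ)) ∈ μ := YoungDiagram.mem_iff_lt_colLen.mpr (by lia)
      refine ⟨μ.colLen j - 1, hc, ?_⟩
      change (if _ ∈ _ then T.1 _ j else if (_, (j : ℕ)) ∈ μ then n else 0) = n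
      rw [if_neg, if_pos hc]
      rw [mem_iff_of_strip hS j.2 hc, not_not]
      exact ⟨by lia, hj.mp h⟩
  · intro T hT
    refine Subtype.ext (SemistandardYoungTableau.ext fun i j => ?_)
    change (if (i, j) ∈ _ then (if (i, j) ∈ _ then T.1 i j else 0)
      else if (i, j) ∈ μ then n else 0) = T.1 i j
    split_ifs with h1 h2
    · rfl
    · exact (not_not.mp ((hlt T (Finset.mem_filter.mp hT).2 i j h2).not.mp h1)).symm
    · exact (T.1.zeros h2).symm
  · intro T _
    refine Subtype.ext (SemistandardYoungTableau.ext fun i j => ?_)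
    change (if (i, j) ∈ _ then (if (i, j) ∈ _ then T.1 i j else if (i, j) ∈ μ then n else 0) else 0)
      = T.1 i j
    split_ifs with h1
    · rfl
    · exact (T.1.zeros h1).symm
  · intro T hT
    rw [MvPowerSeries.X_pow_eq, MvPowerSeries.monomial_mul_monomial, one_mul,
      content_eq_add hμ hS]
    · intro i j hc
      exact (if_pos hc).symm
    · intro i j hc hc'
      exact not_not.mp ((hlt T (Finset.mem_filter.mp hT).2 i j hc).not.mp hc')

open scoped Classical in
include hμ in
/-- The branching rule for Schur polynomials: removing the cells with the largest entry from a
tableau leaves a tableau whose shape differs from `μ` by a horizontal strip. -/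
theorem schurPoly_succ :
    schurPoly (n + 1) μ = ∑ S : Finset (Fin k),
      if hS : IsRemovable μ S then
        MvPowerSeries.X n ^ S.card * schurPoly n (ofColLens k (strippedLen μ S) hS.antitone)
      else 0 := by
  rw [schurPoly, ← Finset.sum_fiberwise _ fun T => topColumns n k T.1]
  refine Finset.sum_congr rfl fun S _ => ?_
  split_ifs with hS
  · exact sum_topColumns_eq hμ hS
  · refine Finset.sum_eq_zero fun T hT => absurd ?_ hS
    rw [← (Finset.mem_filter.mp hT).2]
    exact isRemovable_topColumns hμ T

include hμ in
/-- If removing the bottom cells of the columns in `S` does not leave a Young diagram, then some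
column becomes shorter by one than its right neighbour, or the last column, being empty, gets
length `-1`. -/
theorem jacobiTrudiDet_eq_zero_of_not_isRemovable {u : ℤ → Series} (hu : ∀ m < 0, u m = 0)
    (hS : ¬ IsRemovable μ S) :
    jacobiTrudiDet u (fun j : Fin k => (μ.colLen j : ℤ) - if j ∈ S then 1 else 0) = 0 := by
  unfold IsRemovable at hS
  push Not at hS
  obtain ⟨j, hj, h1, h2⟩ := hS
  obtain ⟨j, hjS, rfl⟩ := Finset.mem_map.mp hj
  rw [Fin.valEmbedding_apply] at *
  have h3 := μ.colLen_anti j (j + 1) (by lia)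
  by_cases hjk : (j : ℕ) + 1 < k
  · have h4 : (⟨j + 1, hjk⟩ : Fin k) ∉ S := fun h =>
      h2 (Finset.mem_map_of_mem Fin.valEmbedding h)
    refine jacobiTrudiDet_eq_zero_of_succ (i := j) (j := ⟨j + 1, hjk⟩) rfl ?_
    rw [if_neg h4, if_pos hjS]
    dsimp only
    lia
  · have h4 : μ.colLen (j + 1) = 0 := by
      by_contra h
      exact hjk (hμ 0 _ (YoungDiagram.mem_iff_lt_colLen.mpr (by lia)))
    refine jacobiTrudiDet_eq_zero_of_last hu (i := j) (by lia) ?_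
    rw [if_pos hjS]
    lia

include hμ in
/-- The dual Jacobi–Trudi formula in finitely many variables, for a shape with at most `k`
columns. -/
theorem schurPoly_eq_jacobiTrudiDet (n : ℕ) :
    schurPoly n μ = jacobiTrudiDet (elemPoly n) (fun j : Fin k => (μ.colLen j : ℤ)) := by
  induction n generalizing μ with
  | zero =>
    by_cases h0 : (0, 0) ∈ μ
    · have : IsEmpty (BoundedTableau 0 μ) := ⟨fun T => by simpa using T.2 0 0 h0⟩
      have hk := hμ _ _ h0
      rw [schurPoly, Finset.univ_eq_empty, Finset.sum_empty, jacobiTrudiDet]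
      refine (Matrix.det_eq_zero_of_row_eq_zero ⟨0, hk⟩ fun l => ?_).symm
      have := YoungDiagram.mem_iff_lt_colLen.mp h0
      simp only [Matrix.of_apply]
      rw [elemPoly_zero, if_neg (by lia)]
    · have hnone : ∀ i j, (i, j) ∉ μ := fun i j h =>
        h0 (μ.up_left_mem (Nat.zero_le _) (Nat.zero_le _) h)
      have hcol : ∀ j, μ.colLen j = 0 := fun j => by
        by_contra h
        exact hnone 0 j (YoungDiagram.mem_iff_lt_colLen.mpr (by lia))
      have hone : (Matrix.of fun i j : Fin k =>
          elemPoly 0 ((μ.colLen i : ℤ) - (i : ℕ) + (j : ℕ))) = 1 := by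
        ext1 i j
        rw [Matrix.of_apply, elemPoly_zero, Matrix.one_apply, hcol]
        refine if_congr ?_ rfl rfl
        rw [Fin.ext_iff]
        lia
      have hcells : μ.cells = ∅ := Finset.eq_empty_of_forall_notMem fun c hc => hnone c.1 c.2 hc
      let T₀ : BoundedTableau 0 μ :=
        ⟨SemistandardYoungTableau.highestWeight μ, fun i j h => absurd h (hnone i j)⟩
      have : Unique (BoundedTableau 0 μ) :=
        { default := T₀
          uniq := fun T => Subtype.ext (SemistandardYoungTableau.ext fun i j => by
            rw [T.1.zeros (hnone i j), T₀.1.zeros (hnone i j)]) }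
      rw [jacobiTrudiDet, hone, Matrix.det_one, schurPoly, Fintype.sum_unique, content, hcells,
        Finset.sum_empty]
      rfl
  | succ n ih =>
    rw [schurPoly_succ hμ, jacobiTrudiDet_expand (elemPoly_succ n)]
    refine Finset.sum_congr rfl fun S _ => ?_
    split_ifs with hS
    · rw [ih fun i j h => (mem_ofColLens.mp h).1]
      congr 2
      funext j
      have hj : j ∈ S ↔ (j : ℕ) ∈ S.map Fin.valEmbedding :=
        (Finset.mem_map' Fin.valEmbedding).symm
      rw [colLen_ofColLens j.2, strippedLen, if_congr hj rfl rfl]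
      have := hS.colLen_pos j
      split_ifs with h
      · have := this h
        lia
      · lia
    · rw [jacobiTrudiDet_eq_zero_of_not_isRemovable hμ (fun m hm => elemPoly_of_neg n hm) hS,
        mul_zero]

end Branching

/-! ### Restriction to finitely many variables -/

section Truncation

/-- The ideal of the power series in which no monomial in `x_0, …, x_{n-1}` alone occurs. The
quotient by it is the power series ring in these `n` variables. -/
def truncIdeal (n : ℕ) : Ideal Series where
  carrier := {f | ∀ d : ℕ →₀ ℕ, d.support ⊆ Finset.range n → MvPowerSeries.coeff d f = 0}
  add_mem' hf hg d hd := by rw [map_add, hf d hd, hg d hd, add_zero]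
  zero_mem' d _ := map_zero _
  smul_mem' f g hg d hd := by
    classical
    rw [smul_eq_mul, MvPowerSeries.coeff_mul]
    refine Finset.sum_eq_zero fun p hp => ?_
    rw [hg p.2, mul_zero]
    refine (Finsupp.support_mono ?_).trans hd
    exact Finset.HasAntidiagonal.mem_antidiagonal.mp hp ▸ le_add_self

theorem mk_truncIdeal_eq {n : ℕ} {f g : Series} :
    Ideal.Quotient.mk (truncIdeal n) f = Ideal.Quotient.mk (truncIdeal n) g ↔
      ∀ d : ℕ →₀ ℕ, d.support ⊆ Finset.range n →
        MvPowerSeries.coeff d f = MvPowerSeries.coeff d g := by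
  rw [Ideal.Quotient.eq]
  refine forall₂_congr fun d hd => ?_
  rw [map_sub, sub_eq_zero]

theorem coeff_genFun {T : Type} (w : T → ℕ →₀ ℕ) (d : ℕ →₀ ℕ) :
    MvPowerSeries.coeff d (genFun w) = (Nat.card {t : T // w t = d} : ℤ) := rfl

theorem squarefreeExp_apply (s : Finset ℕ) (i : ℕ) :
    squarefreeExp s i = if i ∈ s then 1 else 0 := by
  rw [squarefreeExp, Finsupp.finsetSum_apply]
  simp [Finsupp.single_apply]

theorem mk_e (n : ℕ) (k : ℤ) :
    Ideal.Quotient.mk (truncIdeal n) (e k) = Ideal.Quotient.mk (truncIdeal n) (elemPoly n k) := by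
  classical
  refine mk_truncIdeal_eq.mpr fun d hd => ?_
  rw [e, coeff_genFun, Nat.card_congr (Equiv.subtypeSubtypeEquivSubtypeInter
    (fun s : Finset ℕ => (s.card : ℤ) = k) (fun s => squarefreeExp s = d)),
    Nat.subtype_card {s ∈ (Finset.range n).powerset | (s.card : ℤ) = k ∧ squarefreeExp s = d},
    elemPoly, map_sum, Finset.card_filter, Nat.cast_sum]
  · refine Finset.sum_congr rfl fun s _ => ?_
    rw [apply_ite (MvPowerSeries.coeff d), map_zero, MvPowerSeries.coeff_monomial]
    by_cases h1 : (s.card : ℤ) = k <;> by_cases h2 : squarefreeExp s = d <;>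
      simp [h1, h2, eq_comm (a := d)]
  · intro s
    rw [Finset.mem_filter, Finset.mem_powerset]
    refine and_iff_right_of_imp fun h i hi => hd ?_
    rw [Finsupp.mem_support_iff, ← h.2, squarefreeExp_apply, if_pos hi]
    exact one_ne_zero

theorem entry_mem_support_content {μ : YoungDiagram} (T : SemistandardYoungTableau μ) {i j : ℕ}
    (h : (i, j) ∈ μ) : T i j ∈ (content T).support := by
  rw [Finsupp.mem_support_iff, content, Finsupp.finsetSum_apply]
  intro h0
  simpa using (Finset.sum_eq_zero_iff.mp h0) (i, j) h

theorem mk_schur (n : ℕ) (μ : YoungDiagram) :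
    Ideal.Quotient.mk (truncIdeal n) (schur μ)
      = Ideal.Quotient.mk (truncIdeal n) (schurPoly n μ) := by
  classical
  refine mk_truncIdeal_eq.mpr fun d hd => ?_
  have hbound : ∀ T : SemistandardYoungTableau μ, content T = d ↔
      (∀ i j, (i, j) ∈ μ → T i j < n) ∧ content T = d := by
    refine fun T => (and_iff_right_of_imp fun h i j hc => ?_).symm
    exact Finset.mem_range.mp (hd (h ▸ entry_mem_support_content T hc))
  rw [schur, coeff_genFun, Nat.card_congr (Equiv.subtypeEquivRight hbound),
    ← Nat.card_congr (Equiv.subtypeSubtypeEquivSubtypeInter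
      (fun T : SemistandardYoungTableau μ => ∀ i j, (i, j) ∈ μ → T i j < n)
      (fun T => content T = d)),
    Nat.subtype_card (α := BoundedTableau n μ) {T | content T.1 = d} (by simp), schurPoly, map_sum,
    Finset.card_filter, Nat.cast_sum]
  refine Finset.sum_congr rfl fun T _ => ?_
  rw [MvPowerSeries.coeff_monomial]
  by_cases h : content T.1 = d <;> simp [h, eq_comm (a := d)]

end Truncation

/-! ### Homogeneous components -/

section Homogeneous

/-- `f` is homogeneous of degree `k`; an integer, since negative indices of `e` occur. -/
def IsHomog (f : Series) (k : ℤ) : Prop :=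
  ∀ d : ℕ →₀ ℕ, (d.degree : ℤ) ≠ k → MvPowerSeries.coeff d f = 0

variable {f g : Series} {k l : ℤ}

theorem IsHomog.add (hf : IsHomog f k) (hg : IsHomog g k) : IsHomog (f + g) k := fun d hd => by
  rw [map_add, hf d hd, hg d hd, add_zero]

theorem IsHomog.sub (hf : IsHomog f k) (hg : IsHomog g k) : IsHomog (f - g) k := fun d hd => by
  rw [map_sub, hf d hd, hg d hd, sub_zero]

theorem IsHomog.sum {ι : Type*} {s : Finset ι} {f : ι → Series} (h : ∀ i ∈ s, IsHomog (f i) k) :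
    IsHomog (∑ i ∈ s, f i) k := fun d hd => by
  rw [map_sum]
  exact Finset.sum_eq_zero fun i hi => h i hi d hd

theorem IsHomog.mul (hf : IsHomog f k) (hg : IsHomog g l) : IsHomog (f * g) (k + l) := by
  classical
  intro d hd
  rw [MvPowerSeries.coeff_mul]
  refine Finset.sum_eq_zero fun p hp => ?_
  rw [Finset.HasAntidiagonal.mem_antidiagonal] at hp
  by_cases h1 : (p.1.degree : ℤ) = k
  · rw [hg p.2, mul_zero]
    rintro rfl
    apply hd
    rw [← hp, map_add, ← h1]
    push_cast
    rfl
  · rw [hf _ h1, zero_mul]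

theorem IsHomog.congr (hf : IsHomog f k) (h : k = l) : IsHomog f l := h ▸ hf

theorem isHomog_monomial (d : ℕ →₀ ℕ) (a : ℤ) :
    IsHomog (MvPowerSeries.monomial d a) d.degree := fun m hm =>
  MvPowerSeries.coeff_monomial_ne (fun h => hm (by rw [h])) a

theorem degree_squarefreeExp (s : Finset ℕ) : (squarefreeExp s).degree = s.card := by
  simp [squarefreeExp]

theorem degree_content {μ : YoungDiagram} (T : SemistandardYoungTableau μ) :
    (content T).degree = μ.cells.card := by
  simp [content]

theorem isHomog_elemPoly (n : ℕ) (k : ℤ) : IsHomog (elemPoly n k) k := by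
  refine IsHomog.sum fun s _ => ?_
  split_ifs with h
  · exact (isHomog_monomial _ _).congr (by rw [degree_squarefreeExp, h])
  · exact fun d _ => map_zero _

theorem isHomog_schurPoly (n : ℕ) (μ : YoungDiagram) :
    IsHomog (schurPoly n μ) μ.cells.card :=
  IsHomog.sum fun T _ => (isHomog_monomial _ _).congr (by rw [degree_content])

/-- The component of degree `2 * r + a + b` of a product of two sums of homogeneous series is a
single convolution sum. -/
theorem coeff_sum_mul_sum {f g : ℤ → Series} {a b : ℤ} (hf : ∀ k, IsHomog (f k) (2 * k + a))
    (hg : ∀ k, IsHomog (g k) (2 * k + b)) {r m : ℕ} (hr : r < m) {d : ℕ →₀ ℕ}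
    (hd : (d.degree : ℤ) = 2 * r + a + b) :
    MvPowerSeries.coeff d ((∑ k ∈ Finset.range m, f k) * ∑ l ∈ Finset.range m, g l)
      = MvPowerSeries.coeff d (∑ k ∈ Finset.range (r + 1), f k * g ((r : ℤ) - k)) := by
  have hzero : ∀ k l : ℕ, k + l ≠ r → MvPowerSeries.coeff d (f k * g l) = 0 := fun k l h =>
    (hf k).mul (hg l) d (by lia)
  rw [Finset.sum_mul_sum, map_sum, map_sum]
  symm
  refine Finset.sum_subset_zero_on_sdiff (Finset.range_mono hr) ?_ ?_
  · intro k hk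
    rw [Finset.mem_sdiff, Finset.mem_range, Finset.mem_range] at hk
    rw [map_sum]
    exact Finset.sum_eq_zero fun l _ => hzero k l (by lia)
  · intro k hk
    rw [Finset.mem_range] at hk
    rw [map_sum, Finset.sum_eq_single (r - k)]
    · rw [Nat.cast_sub (by lia)]
    · intro l _ hl
      exact hzero k l (by lia)
    · intro h
      rw [Finset.mem_range] at h
      lia

end Homogeneous

/-! ### Partitions with parts at most four -/

section Shape

theorem card_cellsOfRowLens (l : List ℕ) : (YoungDiagram.cellsOfRowLens l).card = l.sum := by
  induction l with
  | nil => rfl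
  | cons a l ih =>
    rw [YoungDiagram.cellsOfRowLens, Finset.card_union_of_disjoint, Finset.card_map, ih]
    · simp
    · rw [Finset.disjoint_left]
      rintro ⟨i, j⟩ h h'
      rw [Finset.mem_product, Finset.mem_singleton] at h
      rw [Finset.mem_map] at h'
      obtain ⟨c, -, hc⟩ := h'
      have := congrArg Prod.fst hc
      simp only [Function.Embedding.prodMap, Function.Embedding.coeFn_mk, Prod.map_fst] at this
      dsimp only at h
      lia

theorem card_cells_diagram {n : ℕ} (p : n.Partition) : (diagram p).cells.card = n := by
  have := card_cellsOfRowLens (p.parts.sort (· ≥ ·))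
  rw [← Multiset.sum_coe, Multiset.sort_eq, p.parts_sum] at this
  exact this

theorem exists_lt_getElem_iff {l : List ℕ} (hl : l.Pairwise (· ≥ ·)) (i j : ℕ) :
    (∃ h : i < l.length, j < l[i]) ↔ i < l.countP (j < ·) := by
  induction l generalizing i with
  | nil => simp
  | cons a l ih =>
    rw [List.pairwise_cons] at hl
    by_cases ha : j < a
    · rw [List.countP_cons_of_pos (by simpa using ha)]
      cases i with
      | zero => simp [ha]
      | succ i => simpa using ih hl.2 i
    · have h0 : (a :: l).countP (j < ·) = 0 := by
        rw [List.countP_eq_zero]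
        intro b hb
        rcases List.mem_cons.mp hb with rfl | hb
        · simpa using ha
        · have := hl.1 b hb
          simp only [decide_eq_true_eq]
          lia
      rw [h0]
      simp only [not_lt_zero, iff_false, not_exists]
      intro hi hj
      have h1 := List.countP_eq_zero.mp h0 _ (List.getElem_mem hi)
      exact h1 (by simpa using hj)

theorem mem_diagram {n : ℕ} (p : n.Partition) (i j : ℕ) :
    (i, j) ∈ diagram p ↔ i < p.parts.countP (j < ·) := by
  rw [diagram, YoungDiagram.mem_ofRowLens]
  refine (exists_lt_getElem_iff (Multiset.pairwise_sort p.parts (· ≥ ·)) i j).trans ?_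
  nth_rewrite 2 [← Multiset.sort_eq p.parts (· ≥ ·)]
  rw [Multiset.coe_countP]

theorem colLen_diagram {n : ℕ} (p : n.Partition) (j : ℕ) :
    (diagram p).colLen j = p.parts.countP (j < ·) := by
  refine eq_of_forall_lt_iff fun i => ?_
  rw [← YoungDiagram.mem_iff_lt_colLen, mem_diagram]

/-- The multiset of parts with `w` parts `4`, `a` parts `3`, `b` parts `2` and `c` parts `1`. -/
def smallParts (w a b c : ℕ) : Multiset ℕ :=
  Multiset.replicate w 4 + Multiset.replicate a 3 + Multiset.replicate b 2 + Multiset.replicate c 1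

theorem countP_replicate_multiset (p : ℕ → Prop) [DecidablePred p] (n a : ℕ) :
    (Multiset.replicate n a).countP p = if p a then n else 0 := by
  rw [← Multiset.coe_replicate, Multiset.coe_countP, List.countP_replicate]
  simp

theorem countP_smallParts (w a b c j : ℕ) :
    (smallParts w a b c).countP (j < ·) = (if j < 4 then w else 0) + (if j < 3 then a else 0)
      + (if j < 2 then b else 0) + (if j < 1 then c else 0) := by
  simp only [smallParts, Multiset.countP_add, countP_replicate_multiset]

theorem sum_smallParts (w a b c : ℕ) :
    (smallParts w a b c).sum = w * 4 + a * 3 + b * 2 + c := by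
  simp [smallParts]

theorem pos_of_mem_smallParts {w a b c i : ℕ} (h : i ∈ smallParts w a b c) : 0 < i := by
  simp only [smallParts, Multiset.mem_add, Multiset.mem_replicate] at h
  lia

theorem rowDet_eq_jacobiTrudiDet {R : Type*} [CommRing R] {u : ℤ → R} {c : ℕ → Fin 4 → R}
    (hc : ∀ i j, c i j = u ((i : ℤ) - (j : ℕ))) (w x y z : ℕ) :
    rowDet (c w) (c x) (c y) (c z)
      = jacobiTrudiDet u ![(z : ℤ) - 3, (y : ℤ) - 2, (x : ℤ) - 1, (w : ℤ)] := by
  rw [rowDet, jacobiTrudiDet, ← Matrix.det_submatrix_equiv_self Fin.revPerm]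
  congr 1
  ext1 i j
  fin_cases i <;> fin_cases j <;> simp [hc, Fin.rev] <;> ring_nf

theorem schurPoly_diagram {m n : ℕ} (p : n.Partition) {w a b c : ℕ}
    (hp : p.parts = smallParts w a b c) :
    schurPoly m (diagram p) = jacobiTrudiDet (elemPoly m)
      ![((w + a + b + c : ℕ) : ℤ), ((w + a + b : ℕ) : ℤ), ((w + a : ℕ) : ℤ), (w : ℤ)] := by
  rw [schurPoly_eq_jacobiTrudiDet (k := 4)]
  · congr 1
    funext j
    rw [colLen_diagram, hp, countP_smallParts]
    fin_cases j <;> simp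
  · intro i j h
    rw [mem_diagram, hp, countP_smallParts] at h
    by_contra hj
    simp [show ¬ j < 4 by lia, show ¬ j < 3 by lia, show ¬ j < 2 by lia,
      show ¬ j < 1 by lia] at h

end Shape

/-! ### The quartic identity -/

section Assembly

/-- The quartic expression in the sequence `u` whose value at the elementary symmetric functions is
the left-hand side of the identity. -/
def quarticSum {R : Type*} [CommRing R] (u : ℤ → R) (r : ℕ) : R :=
  ∑ k ∈ Finset.range (r + 1),
    (u ((k : ℤ) - 1) ^ 2 * u ((r : ℤ) - k) ^ 2 + u ((k : ℤ) - 2) * u k * u ((r : ℤ) - k) ^ 2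
      - 2 * u ((k : ℤ) - 1) * u k * u ((r : ℤ) - k - 1) * u ((r : ℤ) - k))

theorem mk_quarticSum (n r : ℕ) :
    Ideal.Quotient.mk (truncIdeal n) (quarticSum e r)
      = Ideal.Quotient.mk (truncIdeal n) (quarticSum (elemPoly n) r) := by
  simp only [quarticSum, map_sum, map_sub, map_add, map_mul, map_pow, mk_e]

theorem isHomog_quarticSum (n r : ℕ) : IsHomog (quarticSum (elemPoly n) r) (2 * r - 2) := by
  have h := isHomog_elemPoly n
  refine IsHomog.sum fun k _ => ?_
  rw [pow_two, pow_two, mul_assoc (_ * _ * _), mul_assoc 2, mul_assoc 2, two_mul]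
  refine IsHomog.sub (IsHomog.add ?_ ?_) (IsHomog.add ?_ ?_)
  · exact (((h _).mul (h _)).mul ((h _).mul (h _))).congr (by ring)
  · exact (((h _).mul (h _)).mul ((h _).mul (h _))).congr (by ring)
  · exact (((h _).mul (h _)).mul ((h _).mul (h _))).congr (by ring)
  · exact (((h _).mul (h _)).mul ((h _).mul (h _))).congr (by ring)

/-- The quartic sum is a homogeneous component of an expression in three quadratic sums. -/
theorem coeff_quarticSum {n r : ℕ} (hr : r ≤ n) {d : ℕ →₀ ℕ} (hd : (d.degree : ℤ) = 2 * r - 2) :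
    MvPowerSeries.coeff d (quarticSum (elemPoly n) r)
      = MvPowerSeries.coeff d ((∑ l ∈ Finset.range (n + 4), elemPoly n l ^ 2) ^ 2
        + (∑ l ∈ Finset.range (n + 4), elemPoly n l * elemPoly n (l - 2))
          * (∑ l ∈ Finset.range (n + 4), elemPoly n l ^ 2)
        - 2 * (∑ l ∈ Finset.range (n + 4), elemPoly n l * elemPoly n (l - 1)) ^ 2) := by
  have h := isHomog_elemPoly n
  have hu : ∀ k < 0, elemPoly n k = 0 := fun k hk => elemPoly_of_neg n hk
  have hN : ∀ k : ℤ, n < k → elemPoly n k = 0 := fun k hk => elemPoly_of_lt hk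
  have hshift := sum_range_shift (h := fun l => elemPoly n l ^ 2) (m := n + 4) (by simp [hu])
    (by rw [hN _ (by push_cast; lia)]; simp)
  have hsq : ∀ k : ℤ, IsHomog (elemPoly n k ^ 2) (2 * k + 0) := fun k => by
    rw [pow_two]
    exact ((h k).mul (h k)).congr (by ring)
  have hprod : ∀ k : ℤ, IsHomog (elemPoly n k * elemPoly n (k - 1)) (2 * k + -1) := fun k =>
    ((h k).mul (h (k - 1))).congr (by ring)
  have h1 := coeff_sum_mul_sum (f := fun k => elemPoly n (k - 1) ^ 2) (a := -2)
    (fun k => (hsq (k - 1)).congr (by ring)) hsq (r := r) (m := n + 4) (by lia) (d := d) (by lia)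
  have h2 := coeff_sum_mul_sum (f := fun k => elemPoly n k * elemPoly n (k - 2)) (a := -2)
    (fun k => ((h k).mul (h (k - 2))).congr (by ring)) hsq (r := r) (m := n + 4) (by lia) (d := d)
    (by lia)
  have h3 := coeff_sum_mul_sum hprod hprod (r := r) (m := n + 4) (by lia) (d := d) (by lia)
  have hq : quarticSum (elemPoly n) r
      = ∑ k ∈ Finset.range (r + 1), elemPoly n ((k : ℤ) - 1) ^ 2 * elemPoly n ((r : ℤ) - k) ^ 2
        + ∑ k ∈ Finset.range (r + 1), elemPoly n (k : ℤ) * elemPoly n ((k : ℤ) - 2)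
          * elemPoly n ((r : ℤ) - k) ^ 2
        - 2 • ∑ k ∈ Finset.range (r + 1), elemPoly n (k : ℤ) * elemPoly n ((k : ℤ) - 1)
          * (elemPoly n ((r : ℤ) - k) * elemPoly n ((r : ℤ) - k - 1)) := by
    rw [quarticSum, Finset.smul_sum, ← Finset.sum_add_distrib, ← Finset.sum_sub_distrib]
    refine Finset.sum_congr rfl fun k _ => ?_
    rw [nsmul_eq_mul]
    push_cast
    ring
  beta_reduce at hshift h1 h2 h3
  rw [hshift, ← pow_two] at h1
  rw [← pow_two] at h3
  rw [hq, map_sub, map_add, map_nsmul, ← h1, ← h2, ← h3, ← map_nsmul, nsmul_eq_mul, map_sub, map_add,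
    Nat.cast_ofNat]

/-- A partition of the special form corresponds to the increasing quadruple of alternating parity
obtained from its column lengths by adding `(0, 1, 2, 3)`. -/
theorem sum_schurPoly_eq_sum_rowDet {n r : ℕ} (hr : 1 ≤ r) (hn : 2 * r ≤ n) {d : ℕ →₀ ℕ}
    (hd : (d.degree : ℤ) = 2 * r - 2) {c : ℕ → Fin 4 → Series}
    (hc : ∀ i j, c i j = elemPoly n ((i : ℤ) - (j : ℕ)))
    (s : Finset (2 * r - 2).Partition) (hs : ∀ p, p ∈ s ↔ HasSpecialForm p) :
    ∑ p ∈ s, MvPowerSeries.coeff d (schurPoly n (diagram p))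
      = ∑ z ∈ Finset.range (n + 4), ∑ y ∈ Finset.range z, ∑ x ∈ Finset.range y,
          ∑ w ∈ Finset.range x, MvPowerSeries.coeff d
            (if Odd (z + y) ∧ Odd (y + x) ∧ Odd (x + w) then rowDet (c w) (c x) (c y) (c z)
              else 0) := by
  have hsigma : ∀ F : ℕ → ℕ → ℕ → ℕ → ℤ, ∑ z ∈ Finset.range (n + 4), ∑ y ∈ Finset.range z,
      ∑ x ∈ Finset.range y, ∑ w ∈ Finset.range x, F w x y z
        = ∑ q ∈ (Finset.range (n + 4)).sigma fun z => (Finset.range z).sigma fun y =>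
            (Finset.range y).sigma fun x => Finset.range x, F q.2.2.2 q.2.2.1 q.2.1 q.1 := by
    intro F
    simp only [Finset.sum_sigma]
  rw [hsigma]
  have hform : ∀ p ∈ s, ∃ i₁ i₂ i₃ i₄ : ℕ,
      p.parts = smallParts i₄ (2 * i₃) (2 * i₂) (2 * i₁) := fun p hp => (hs p).mp hp
  have hdet : ∀ {m : ℕ} (p : m.Partition) {w a b l : ℕ}, p.parts = smallParts w a b l →
      schurPoly n (diagram p) = rowDet (c w) (c (w + a + 1)) (c (w + a + b + 2))
        (c (w + a + b + l + 3)) := by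
    intro m p w a b l hp
    rw [schurPoly_diagram p hp, rowDet_eq_jacobiTrudiDet hc]
    push_cast
    simp only [add_sub_cancel_right]
  have hodd : ∀ {x y : ℕ}, Odd (x + y) ↔ (x + y) % 2 = 1 := Nat.odd_iff
  let φ : (2 * r - 2).Partition → Σ _ : ℕ, Σ _ : ℕ, Σ _ : ℕ, ℕ := fun p =>
    ⟨p.parts.countP (0 < ·) + 3, p.parts.countP (1 < ·) + 2, p.parts.countP (2 < ·) + 1,
      p.parts.countP (3 < ·)⟩
  have hφ : ∀ (p : (2 * r - 2).Partition) {w a b l : ℕ}, p.parts = smallParts w a b l →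
      φ p = ⟨w + a + b + l + 3, w + a + b + 2, w + a + 1, w⟩ := by
    intro p w a b l hp
    simp [φ, hp, countP_smallParts]
  refine Finset.sum_of_injOn φ ?_ ?_ ?_ ?_
  · intro p hp p' hp' h
    obtain ⟨i₁, i₂, i₃, i₄, h1⟩ := hform p hp
    obtain ⟨j₁, j₂, j₃, j₄, h2⟩ := hform p' hp'
    rw [hφ p h1, hφ p' h2] at h
    simp only [Sigma.mk.injEq, heq_eq_eq] at h
    obtain ⟨h3, h4, h5, h6⟩ := h
    refine Nat.Partition.ext ?_
    rw [h1, h2]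
    congr 1 <;> lia
  · intro p hp
    obtain ⟨i₁, i₂, i₃, i₄, h1⟩ := hform p hp
    have hsum := p.parts_sum
    rw [h1, sum_smallParts] at hsum
    rw [hφ p h1]
    simp only [Finset.coe_sigma, Set.mem_sigma_iff, Finset.mem_coe, Finset.mem_range]
    lia
  · rintro ⟨z, y, x, w⟩ hq hnot
    simp only [Finset.mem_sigma, Finset.mem_range] at hq
    dsimp only
    split_ifs with hpar
    · rw [hodd, hodd, hodd] at hpar
      have hparts : ∀ m : ℕ, (smallParts w (x - w - 1) (y - x - 1) (z - y - 1)).sum = m →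
          ∃ p : m.Partition, p.parts = smallParts w (x - w - 1) (y - x - 1) (z - y - 1) :=
        fun m h => ⟨⟨_, pos_of_mem_smallParts, h⟩, rfl⟩
      by_cases hsize : (smallParts w (x - w - 1) (y - x - 1) (z - y - 1)).sum = 2 * r - 2
      · obtain ⟨p, hp⟩ := hparts _ hsize
        refine absurd ⟨p, ?_, ?_⟩ hnot
        · refine (hs p).mpr ⟨(z - y - 1) / 2, (y - x - 1) / 2, (x - w - 1) / 2, w, ?_⟩
          rw [hp, smallParts]
          congr 3 <;> congr 1 <;> lia
        · rw [hφ p hp]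
          simp only [Sigma.mk.injEq, heq_eq_eq]
          lia
      · obtain ⟨p, hp⟩ := hparts _ rfl
        have h1 := hdet p hp
        rw [show w + (x - w - 1) + 1 = x by lia, show w + (x - w - 1) + (y - x - 1) + 2 = y by lia,
          show w + (x - w - 1) + (y - x - 1) + (z - y - 1) + 3 = z by lia] at h1
        rw [← h1]
        refine isHomog_schurPoly n _ d ?_
        rw [card_cells_diagram]
        lia
    · exact map_zero _
  · intro p hp
    obtain ⟨i₁, i₂, i₃, i₄, h1⟩ := hform p hp
    rw [hφ p h1, if_pos, hdet p h1]
    simp only [hodd]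
    lia

theorem quarticSum_eq_sum_schur {r : ℕ} (hr : 1 ≤ r) (s : Finset (2 * r - 2).Partition)
    (hs : ∀ p, p ∈ s ↔ HasSpecialForm p) :
    quarticSum e r = ∑ p ∈ s, schur (diagram p) := by
  ext d
  obtain ⟨n, hn, hd⟩ : ∃ n, 2 * r ≤ n ∧ d.support ⊆ Finset.range n := by
    obtain ⟨m, hm⟩ := d.support.exists_nat_subset_range
    exact ⟨max (2 * r) m, le_max_left _ _, hm.trans (Finset.range_mono (le_max_right _ _))⟩
  rw [mk_truncIdeal_eq.mp (mk_quarticSum n r) d hd, map_sum,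
    Finset.sum_congr rfl fun p _ => mk_truncIdeal_eq.mp (mk_schur n (diagram p)) d hd]
  by_cases hdeg : (d.degree : ℤ) = 2 * r - 2
  · rw [coeff_quarticSum (by lia) hdeg, ← sum_alternating_rowDet
      (fun k hk => elemPoly_of_neg n hk) (fun k hk => elemPoly_of_lt hk)
      (fun i j => elemPoly n ((i : ℤ) - (j : ℕ))) (fun _ _ => rfl),
      sum_schurPoly_eq_sum_rowDet hr hn hdeg (fun _ _ => rfl) s hs]
    simp only [map_sum]
  · rw [isHomog_quarticSum n r d hdeg, Finset.sum_eq_zero]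
    intro p _
    refine isHomog_schurPoly n _ d ?_
    rw [card_cells_diagram]
    lia

theorem schurPositive_sum {ι : Type*} (s : Finset ι) (f : ι → YoungDiagram) :
    SchurPositive (∑ i ∈ s, schur (f i)) := by
  classical
  refine ⟨∑ i ∈ s, Finsupp.single (f i) 1, fun μ => ?_, ?_⟩
  · rw [Finsupp.finsetSum_apply]
    exact Finset.sum_nonneg fun i _ => by
      rw [Finsupp.single_apply]
      split_ifs <;> simp
  · change _ = Finsupp.sum (∑ i ∈ s, Finsupp.single (f i) (1 : ℤ)) fun μ a => a • schur μ
    rw [← Finsupp.sum_finsetSum_index (h := fun μ (a : ℤ) => a • schur μ)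
      (fun _ => zero_smul _ _) (fun _ _ _ => add_smul _ _ _)]
    refine Finset.sum_congr rfl fun i _ => ?_
    rw [Finsupp.sum_single_index (h := fun μ (a : ℤ) => a • schur μ) (zero_smul _ _)]
    exact (one_smul ℤ _).symm

end Assembly

end SymFun

open scoped Classical in
theorem theorem3p1 (r : ℕ) (hr : 1 ≤ r) :
    (∑ k ∈ Finset.range (r + 1),
        (SymFun.e ((k : ℤ) - 1) ^ 2 * SymFun.e ((r : ℤ) - k) ^ 2
          + SymFun.e ((k : ℤ) - 2) * SymFun.e k * SymFun.e ((r : ℤ) - k) ^ 2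
          - 2 * SymFun.e ((k : ℤ) - 1) * SymFun.e k
              * SymFun.e ((r : ℤ) - k - 1) * SymFun.e ((r : ℤ) - k))
      = ∑ p : (2 * r - 2).Partition with SymFun.HasSpecialForm p,
          SymFun.schur (SymFun.diagram p))
    ∧ SymFun.SchurPositive
        (∑ k ∈ Finset.range (r + 1),
          (SymFun.e ((k : ℤ) - 1) ^ 2 * SymFun.e ((r : ℤ) - k) ^ 2
            + SymFun.e ((k : ℤ) - 2) * SymFun.e k * SymFun.e ((r : ℤ) - k) ^ 2
            - 2 * SymFun.e ((k : ℤ) - 1) * SymFun.e k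
                * SymFun.e ((r : ℤ) - k - 1) * SymFun.e ((r : ℤ) - k))) := by
  have h := SymFun.quarticSum_eq_sum_schur hr
    {p : (2 * r - 2).Partition | SymFun.HasSpecialForm p} (by simp)
  rw [SymFun.quarticSum] at h
  refine ⟨h, ?_⟩
  rw [h]
  exact SymFun.schurPositive_sum _ _
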